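/- A DFA is a triple $M=(Q,\Sigma,\cdot)$ with finite state set $Q$, finite alphabet $\Sigma$ and a total transition function $Q\times\Sigma\to Q$, extended to words $w\in\Sigma^*$ and to subsets of $Q$ by $Sw=\{qw : q\in S\}$. It is binary if $|\Sigma|=2$, and transitive if for all $q,q'\in Q$ there is a word $w$ with $qw=q'$. A subset $S\subseteq Q$ is synchronizable if $|Sw|=1$ for some word $w$; such a $w$ is called a synchronizing word for $S$. Theorem. For every $n\ge 1$ there are a transitive binary DFA $M_n$ with exactly $n$ states and a synchronizable subset $S_n$ of its states such that the length $\ell(n)$ of a shortest synchronizing word for $S_n$ satisfies $$\ell(n)=\Omega\big((3-\varepsilon)^{n/6}\big)\quad\text{for every real }\varepsilon\text{ with }0<\varepsilon<3,$$ where the implied constant and threshold may depend on $\varepsilon$. In particular, $\ell(n)=\Omega(1.2009^n)$. (Here $\ell(n)=\Omega(g(n))$ means that there are a constant $c>0$ and an $N$ such that $\ell(n)\ge c\,g(n)$ for all $n\ge N$.) -/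

import Mathlib

open Filter Asymptotics

/-- A deterministic finite automaton `(Q, Σ, ·)` in the sense of synchronization theory: a total
transition function on the state set `Q`, with alphabet `A`, without initial or final states. -/
structure Automaton (Q A : Type*) where
  /-- `step q a` is the state `q · a`. -/
  step : Q → A → Q

namespace Automaton

variable {Q A : Type*}

/-- The state `q w` reached from `q` by reading the word `w` from left to right. -/
def run (M : Automaton Q A) (q : Q) (w : List A) : Q := w.foldl M.step q

/-- The set `S w = {q w | q ∈ S}`. -/
def image (M : Automaton Q A) (S : Set Q) (w : List A) : Set Q := (fun q => M.run q w) '' S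

/-- For every pair `(q, q')` of states there is a word `w` with `q w = q'`. -/
def Transitive (M : Automaton Q A) : Prop := ∀ q q' : Q, ∃ w : List A, M.run q w = q'

/-- `M` is synchronizing on `S` in `l` steps: some word `w` of length `l` makes `S w` have
exactly one element. -/
def SynchronizesIn (M : Automaton Q A) (S : Set Q) (l : ℕ) : Prop :=
  ∃ w : List A, w.length = l ∧ (M.image S w).ncard = 1

/-- `S` is synchronizable in `M`, and its shortest synchronizing word has length `l`. -/
def ShortestSyncLength (M : Automaton Q A) (S : Set Q) (l : ℕ) : Prop :=
  IsLeast {m : ℕ | M.SynchronizesIn S m} l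

end Automaton

/-! A synchronizing word is forced to count in base 3. In `counter m` the `m + 4` tokens of `initial
m` go around a cycle of `m + 5` places, one staying empty, and each carries a ternary digit. The
letters are the carries: in its last place a token with digit `v` has seen its carry in `c` and
carry out `d`, and goes on with the digit `v'` such that `v + c = v' + 3 d`. If there is none, it
meets the witness, which stores the last four letters, with opposite sign. Transitions commute with
the change of sign, so this error is never repaired (`HasTwins.concat`).

A token joins the witness properly only by an overflow: digit 2, carry in 1, carry out 0, next
letter 1. A token whose turn comes next would see carry in 0 and carry out 1, which no digit allows.
So the top token must leave first, when the counter has reached `3 ^ (m + 4)`; the value grows by at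
most one per round, whence the lower bound (`Counting.concat`, `three_pow_le_length`). Conversely,
with correct carries the tokens leave one by one from the top (`exists_synchronizing_of_config`).

Each place costs 3 digits times 2 signs, hence the base `3 ^ (1 / 6)`. Lengthening a loop
(`padLoop`) reaches the state counts between the values `6 m + 218`. -/

namespace Automaton

variable {Q A : Type*}

/-! ### Words, reachability and slow synchronization -/

@[simp] theorem run_nil (M : Automaton Q A) (q : Q) : M.run q [] = q := rfl

@[simp] theorem run_cons (M : Automaton Q A) (q : Q) (a : A) (w : List A) :
    M.run q (a :: w) = M.run (M.step q a) w := rfl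

theorem run_append (M : Automaton Q A) (q : Q) (u v : List A) :
    M.run q (u ++ v) = M.run (M.run q u) v := List.foldl_append

theorem run_concat (M : Automaton Q A) (q : Q) (w : List A) (a : A) :
    M.run q (w ++ [a]) = M.step (M.run q w) a := by simp [run_append]

/-- `q'` is reached from `q` by some word. -/
def Reaches (M : Automaton Q A) (q q' : Q) : Prop := ∃ w : List A, M.run q w = q'

theorem Reaches.refl (M : Automaton Q A) (q : Q) : M.Reaches q q := ⟨[], rfl⟩

theorem Reaches.trans {M : Automaton Q A} {p q r : Q} (h : M.Reaches p q) (h' : M.Reaches q r) :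
    M.Reaches p r := by
  obtain ⟨u, rfl⟩ := h
  obtain ⟨v, rfl⟩ := h'
  exact ⟨u ++ v, M.run_append p u v⟩

theorem image_ncard_eq_one_iff (M : Automaton Q A) (S : Set Q) (w : List A) :
    (M.image S w).ncard = 1 ↔ S.Nonempty ∧ ∃ c, ∀ q ∈ S, M.run q w = c := by
  rw [Set.ncard_eq_one]
  constructor
  · rintro ⟨c, hc⟩
    refine ⟨?_, c, fun q hq => ?_⟩
    · rw [← Set.image_nonempty (f := fun q => M.run q w)]
      exact ⟨c, by rw [image] at hc; rw [hc]; rfl⟩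
    · have : M.run q w ∈ M.image S w := ⟨q, hq, rfl⟩
      rwa [hc] at this
  · rintro ⟨⟨q, hq⟩, c, hc⟩
    refine ⟨c, Set.ext fun p => ⟨?_, ?_⟩⟩
    · rintro ⟨r, hr, rfl⟩
      exact hc r hr
    · rintro rfl
      exact ⟨q, hq, hc q hq⟩

/-- Some word synchronizes `S`, and every word that does has length at least `B`. -/
def SlowlySynchronizable (M : Automaton Q A) (S : Set Q) (B : ℕ) : Prop :=
  (∃ w, (M.image S w).ncard = 1) ∧ ∀ w, (M.image S w).ncard = 1 → B ≤ w.length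

theorem SlowlySynchronizable.exists_shortest {M : Automaton Q A} {S : Set Q} {B : ℕ}
    (h : M.SlowlySynchronizable S B) : ∃ l, M.ShortestSyncLength S l ∧ B ≤ l := by
  classical
  obtain ⟨⟨w, hw⟩, hB⟩ := h
  have hex : ∃ l, M.SynchronizesIn S l := ⟨_, w, rfl, hw⟩
  refine ⟨Nat.find hex, ⟨Nat.find_spec hex, fun l hl => Nat.find_min' hex hl⟩, ?_⟩
  obtain ⟨v, hv, hv'⟩ := Nat.find_spec hex
  exact hv ▸ hB v hv'

/-! ### Renaming states and padding to a given number of states -/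

/-- The automaton with its states renamed along an equivalence. -/
def rename {Q' : Type*} (M : Automaton Q A) (e : Q ≃ Q') : Automaton Q' A where
  step q a := e (M.step (e.symm q) a)

section rename

variable {Q' : Type*} (M : Automaton Q A) (e : Q ≃ Q')

theorem rename_run (q : Q') (w : List A) : (M.rename e).run q w = e (M.run (e.symm q) w) := by
  induction w generalizing q with
  | nil => simp
  | cons a w ih =>
    rw [run_cons, run_cons, ih]
    simp [rename]

variable {M}

theorem Transitive.rename (h : M.Transitive) : (M.rename e).Transitive := fun q q' => by
  obtain ⟨w, hw⟩ := h (e.symm q) (e.symm q')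
  exact ⟨w, by rw [rename_run, hw, e.apply_symm_apply]⟩

theorem SlowlySynchronizable.rename {S : Set Q} {B : ℕ} (h : M.SlowlySynchronizable S B) :
    (M.rename e).SlowlySynchronizable (e '' S) B := by
  have key : ∀ w, (M.rename e).image (e '' S) w = e '' M.image S w := fun w => by
    simp only [image, Set.image_image, rename_run, e.symm_apply_apply]
  have key' : ∀ w, ((M.rename e).image (e '' S) w).ncard = (M.image S w).ncard := fun w => by
    rw [key, Set.ncard_image_of_injective _ e.injective]
  simpa only [SlowlySynchronizable, key'] using h

end rename

/-- A state `x` with a loop labelled `0` is replaced by a cycle of `r + 1` copies. -/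
def padLoop [DecidableEq Q] (M : Automaton Q (Fin 2)) (x : Q) (r : ℕ) :
    Automaton (Q ⊕ Fin r) (Fin 2) where
  step
    | .inl q, a => if h : q = x ∧ a = 0 ∧ 0 < r then .inr ⟨0, h.2.2⟩ else .inl (M.step q a)
    | .inr i, a => if h : a = 0 ∧ i + 1 < r then .inr ⟨i + 1, h.2⟩ else .inl (M.step x a)

section padLoop

variable [DecidableEq Q] (M : Automaton Q (Fin 2)) (x : Q) (r : ℕ)

/-- As `x` loops under `0`, collapsing the copies onto `x` is a homomorphism to `M`. Synchronizing
words therefore stay synchronizing in `M`, and the lower bound survives padding. -/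
theorem padLoop_run_collapse (hx : M.step x 0 = x) (z : Q ⊕ Fin r) (w : List (Fin 2)) :
    Sum.elim id (fun _ => x) ((M.padLoop x r).run z w) = M.run (Sum.elim id (fun _ => x) z) w := by
  induction w generalizing z with
  | nil => rfl
  | cons a w ih =>
    rw [run_cons, run_cons, ih]
    congr 1
    rcases z with q | i
    · simp only [padLoop]
      split_ifs with h
      · simp [h.1, h.2.1, hx]
      · rfl
    · simp only [padLoop]
      split_ifs with h
      · simp [h.1, hx]
      · rfl

/-- The letter `1` leads out of all copies, so one more `1` turns equality after collapsing into
equality. -/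
theorem padLoop_step_one (z : Q ⊕ Fin r) :
    (M.padLoop x r).step z 1 = .inl (M.step (Sum.elim id (fun _ => x) z) 1) := by
  rcases z with q | i <;> simp [padLoop]

variable {M x}

theorem padLoop_reaches_copy (i : Fin r) : (M.padLoop x r).Reaches (.inl x) (.inr i) := by
  obtain ⟨i, hi⟩ := i
  induction i with
  | zero => exact ⟨[0], by simp [padLoop, hi]⟩
  | succ i ih => exact (ih (by omega)).trans ⟨[0], by simp [padLoop, hi]⟩

theorem padLoop_reaches_loop (hx : M.step x 0 = x) (i : Fin r) :
    (M.padLoop x r).Reaches (.inr i) (.inl x) := by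
  obtain ⟨i, hi⟩ := i
  obtain ⟨k, hk⟩ : ∃ k, i + k + 1 = r := ⟨r - i - 1, by omega⟩
  induction k generalizing i with
  | zero => exact ⟨[0], by simp [padLoop, ← hk, hx]⟩
  | succ k ih =>
    refine Reaches.trans ⟨[0], ?_⟩ (ih (i + 1) (by omega) (by omega))
    have : i + 1 < r := by omega
    simp [padLoop, this]

theorem padLoop_reaches_run (hx : M.step x 0 = x) (q : Q) (w : List (Fin 2)) :
    (M.padLoop x r).Reaches (.inl q) (.inl (M.run q w)) := by
  induction w generalizing q with
  | nil => exact .refl _ _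
  | cons a w ih =>
    by_cases h : q = x ∧ a = 0
    -- The loop letter is dropped from the word, since it would lead into the copies.
    · simpa [h.1, h.2, hx] using ih q
    · refine Reaches.trans ⟨[a], ?_⟩ (ih _)
      have : ¬ (q = x ∧ a = 0 ∧ 0 < r) := fun h' => h ⟨h'.1, h'.2.1⟩
      simp [padLoop, this]

theorem Transitive.padLoop (h : M.Transitive) (hx : M.step x 0 = x) :
    (M.padLoop x r).Transitive := by
  intro z z'
  have h1 : (M.padLoop x r).Reaches z (.inl x) := by
    rcases z with q | i
    · obtain ⟨w, hw⟩ := h q x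
      exact hw ▸ padLoop_reaches_run r hx q w
    · exact padLoop_reaches_loop r hx i
  refine h1.trans ?_
  rcases z' with q | i
  · obtain ⟨w, hw⟩ := h x q
    exact hw ▸ padLoop_reaches_run r hx x w
  · exact padLoop_reaches_copy r i

theorem SlowlySynchronizable.padLoop {S : Set Q} {B : ℕ} (h : M.SlowlySynchronizable S B)
    (hx : M.step x 0 = x) : (M.padLoop x r).SlowlySynchronizable (Sum.inl '' S) B := by
  constructor
  · obtain ⟨w, hw⟩ := h.1
    obtain ⟨hS, c, hc⟩ := (image_ncard_eq_one_iff _ _ _).1 hw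
    refine ⟨w ++ [1], (image_ncard_eq_one_iff _ _ _).2 ⟨hS.image _, .inl (M.step c 1), ?_⟩⟩
    rintro _ ⟨q, hq, rfl⟩
    rw [run_concat, padLoop_step_one, padLoop_run_collapse M x r hx, ← hc q hq]
    rfl
  · intro w hw
    obtain ⟨hS, c, hc⟩ := (image_ncard_eq_one_iff _ _ _).1 hw
    refine h.2 w ((image_ncard_eq_one_iff _ _ _).2
      ⟨hS.of_image, Sum.elim id (fun _ => x) c, fun q hq => ?_⟩)
    rw [← hc _ ⟨q, hq, rfl⟩, padLoop_run_collapse M x r hx]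
    rfl

end padLoop

theorem exists_fin_of_loop [Fintype Q] {M : Automaton Q (Fin 2)} {S : Set Q} {B n : ℕ} {x : Q}
    (hn : Fintype.card Q ≤ n) (hM : M.Transitive) (hS : M.SlowlySynchronizable S B)
    (hx : M.step x 0 = x) :
    ∃ (M' : Automaton (Fin n) (Fin 2)) (S' : Set (Fin n)) (l : ℕ),
      M'.Transitive ∧ M'.ShortestSyncLength S' l ∧ B ≤ l := by
  classical
  have e : Q ⊕ Fin (n - Fintype.card Q) ≃ Fin n :=
    Fintype.equivFinOfCardEq (by simp; omega)
  obtain ⟨l, hl⟩ := ((hS.padLoop (n - Fintype.card Q) hx).rename e).exists_shortest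
  exact ⟨_, _, l, (hM.padLoop _ hx).rename e, hl⟩

/-- The cyclic automaton with a singleton. -/
theorem exists_fin_trivial {n : ℕ} (hn : 1 ≤ n) :
    ∃ (M : Automaton (Fin n) (Fin 2)) (S : Set (Fin n)),
      M.Transitive ∧ M.ShortestSyncLength S 0 := by
  obtain ⟨n, rfl⟩ : ∃ k, n = k + 1 := ⟨n - 1, by omega⟩
  let M : Automaton (Fin (n + 1)) (Fin 2) := ⟨fun q _ => ⟨(q + 1) % (n + 1), Nat.mod_lt _ hn⟩⟩
  have hrun : ∀ (k : ℕ) (q : Fin (n + 1)),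
      (M.run q (List.replicate k 0)).val = (q + k) % (n + 1) := by
    intro k
    induction k with
    | zero => intro q; simp [Nat.mod_eq_of_lt q.isLt]
    | succ k ih =>
      intro q
      rw [List.replicate_succ, run_cons, ih]
      simp only [M, Nat.mod_add_mod]
      congr 1
      omega
  refine ⟨M, {0}, fun q q' => ⟨List.replicate (q' + (n + 1) - q) 0, Fin.ext ?_⟩,
    ⟨[], rfl, ?_⟩, fun _ _ => Nat.zero_le _⟩
  · rw [hrun, show q.val + (q' + (n + 1) - q) = q' + (n + 1) by omega, Nat.add_mod_right,
      Nat.mod_eq_of_lt q'.isLt]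
  · simp [image]

/-! ### Signed automata and twins -/

/-- The automaton of a transition function with signs; it commutes with the change of sign. -/
def signed {R : Type*} (δ : R → A → R × Bool) : Automaton (R × Bool) A where
  step q a := ((δ q.1 a).1, xor q.2 (δ q.1 a).2)

/-- Two states of `S` are taken by `w` to states that differ by their sign only. -/
def HasTwins {R : Type*} (M : Automaton (R × Bool) A) (S : Set (R × Bool)) (w : List A) : Prop :=
  ∃ q ∈ S, ∃ q' ∈ S, (M.run q w).1 = (M.run q' w).1 ∧ (M.run q w).2 ≠ (M.run q' w).2

/-- The sign change depends only on the unsigned state and the letter, so twins move together and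
their signs stay opposite. -/
theorem HasTwins.concat {R : Type*} {δ : R → A → R × Bool} {S : Set (R × Bool)} {w : List A}
    (h : (signed δ).HasTwins S w) (a : A) : (signed δ).HasTwins S (w ++ [a]) := by
  obtain ⟨q, hq, q', hq', h1, h2⟩ := h
  refine ⟨q, hq, q', hq', ?_, ?_⟩
  · simp only [run_concat, signed] at h1 ⊢
    rw [h1]
  · simp only [run_concat, signed] at h1 h2 ⊢
    rw [h1]
    simpa using h2

theorem HasTwins.ncard_ne_one {R : Type*} {M : Automaton (R × Bool) A} {S : Set (R × Bool)}
    {w : List A} (h : M.HasTwins S w) : (M.image S w).ncard ≠ 1 := by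
  intro h1
  obtain ⟨-, c, hc⟩ := (image_ncard_eq_one_iff _ _ _).1 h1
  obtain ⟨q, hq, q', hq', -, h2⟩ := h
  exact h2 (by rw [hc q hq, hc q' hq'])

end Automaton

namespace TernaryCounter

open Automaton

/-! ### The counter automaton -/

/-- States of a token: a digit `v` that waits, a digit together with the letters read so far, or
the last four letters. -/
inductive State (m : ℕ)
  | idle (p : Fin (m + 1)) (v : Fin 3)
  | read1 (v : Fin 3) (d : Fin 2)
  | read2 (v : Fin 3) (c d : Fin 2)
  | read3 (v : Fin 3) (b c d : Fin 2)
  | read4 (v : Fin 3) (a b c d : Fin 2)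
  | recent (a b c d : Fin 2)

namespace State

variable {m : ℕ}

/-- The type of states as a sum of products. -/
def equivSum (m : ℕ) : State m ≃
    (Fin (m + 1) × Fin 3) ⊕ (Fin 3 × Fin 2) ⊕ (Fin 3 × Fin 2 × Fin 2) ⊕
      (Fin 3 × Fin 2 × Fin 2 × Fin 2) ⊕ (Fin 3 × Fin 2 × Fin 2 × Fin 2 × Fin 2) ⊕
      (Fin 2 × Fin 2 × Fin 2 × Fin 2) where
  toFun
    | idle p v => .inl (p, v)
    | read1 v d => .inr (.inl (v, d))
    | read2 v c d => .inr (.inr (.inl (v, c, d)))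
    | read3 v b c d => .inr (.inr (.inr (.inl (v, b, c, d))))
    | read4 v a b c d => .inr (.inr (.inr (.inr (.inl (v, a, b, c, d)))))
    | recent a b c d => .inr (.inr (.inr (.inr (.inr (a, b, c, d)))))
  invFun
    | .inl (p, v) => idle p v
    | .inr (.inl (v, d)) => read1 v d
    | .inr (.inr (.inl (v, c, d))) => read2 v c d
    | .inr (.inr (.inr (.inl (v, b, c, d)))) => read3 v b c d
    | .inr (.inr (.inr (.inr (.inl (v, a, b, c, d))))) => read4 v a b c d
    | .inr (.inr (.inr (.inr (.inr (a, b, c, d))))) => recent a b c d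
  left_inv s := by cases s <;> rfl
  right_inv s := by rcases s with s | s | s | s | s | s <;> rfl

instance : Fintype (State m) := Fintype.ofEquiv _ (equivSum m).symm

theorem card_prod_bool : Fintype.card (State m × Bool) = 6 * m + 218 := by
  rw [Fintype.card_prod, Fintype.card_congr (equivSum m)]
  simp only [Fintype.card_sum, Fintype.card_prod, Fintype.card_fin, Fintype.card_bool]
  omega

end State

open State

variable {m : ℕ}

/-- The successor of the last four letters `a b c d` under the letter `x`; after `0 1 0 1` the
token goes back to the counter. -/
def successor (m : ℕ) (a b c d x : Fin 2) : State m :=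
  if a = 0 ∧ b = 1 ∧ c = 0 ∧ d = 1 then idle 0 0 else recent b c d x

/-- The end of the reading of `a b c d x` by the digit `v`: the digit `v + c - 3 d` if this is
one, otherwise the state of a token that keeps the last letters, with change of sign unless
`v = 2` and `c d x` is `1 0 1`. -/
def complete (m : ℕ) (v : Fin 3) (a b c d x : Fin 2) : State m × Bool :=
  if h : 3 * d.val ≤ v.val + c.val ∧ v.val + c.val < 3 * d.val + 3 then
    (idle 0 ⟨v + c - 3 * d, by omega⟩, false)
  else (successor m a b c d x, !decide (v = 2 ∧ c = 1 ∧ d = 0 ∧ x = 1))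

/-- The transition function, with signs. -/
def transition (m : ℕ) : State m → Fin 2 → State m × Bool
  | idle p v, x => if h : p.val + 1 < m + 1 then (idle ⟨p + 1, h⟩ v, false) else (read1 v x, false)
  | read1 v d, x => (read2 v d x, false)
  | read2 v c d, x => (read3 v c d x, false)
  | read3 v b c d, x => (read4 v b c d x, false)
  | read4 v a b c d, x => complete m v a b c d x
  | recent a b c d, x => (successor m a b c d x, false)

/-- The counter automaton. -/
def counter (m : ℕ) : Automaton (State m × Bool) (Fin 2) := signed (transition m)

theorem counter_step (r : State m) (s : Bool) (x : Fin 2) :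
    (counter m).step (r, s) x = ((transition m r x).1, xor s (transition m r x).2) := rfl

theorem complete_of_eq {v v' : Fin 3} {a b c d x : Fin 2} (h : v.val + c = v' + 3 * d) :
    complete m v a b c d x = (idle 0 v', false) := by
  rw [complete, dif_pos (by omega)]
  congr
  omega

theorem complete_exit (a b : Fin 2) :
    complete m 2 a b 1 0 1 = (recent b 1 0 1, false) := by
  rw [complete, dif_neg (by simp)]
  simp [successor]

theorem complete_of_ne {v : Fin 3} {a b c d x : Fin 2}
    (h : ∀ v' : Fin 3, v.val + c ≠ v' + 3 * d) (h' : ¬ (v = 2 ∧ c = 1 ∧ d = 0 ∧ x = 1)) :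
    complete m v a b c d x = (successor m a b c d x, true) := by
  rw [complete, dif_neg fun h1 => h ⟨v + c - 3 * d, by omega⟩ (by simp; omega)]
  simp [h']

/-! ### Transitivity -/

theorem reaches_step (r : State m) (s : Bool) (x : Fin 2) :
    (counter m).Reaches (r, s) ((transition m r x).1, xor s (transition m r x).2) := ⟨[x], rfl⟩

theorem reaches_idle_last (p : Fin (m + 1)) (v : Fin 3) (s : Bool) :
    (counter m).Reaches (idle p v, s) (idle (Fin.last m) v, s) := by
  induction p using Fin.reverseInduction with
  | last => exact .refl _ _
  | cast p ih =>
    refine Reaches.trans ⟨[0], ?_⟩ ih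
    simp [counter_step, transition]
    rfl

theorem idle_zero_reaches (p : Fin (m + 1)) (v : Fin 3) (s : Bool) :
    (counter m).Reaches (idle 0 v, s) (idle p v, s) := by
  induction p using Fin.induction with
  | zero => exact .refl _ _
  | succ p ih =>
    refine ih.trans ⟨[0], ?_⟩
    simp [counter_step, transition]
    rfl

theorem run_idle_last (v : Fin 3) (s : Bool) (a b c d : Fin 2) :
    (counter m).run (idle (Fin.last m) v, s) [a, b, c, d] = (read4 v a b c d, s) := by
  simp [counter_step, transition]

theorem idle_reaches_read4 (p : Fin (m + 1)) (v : Fin 3) (s : Bool) (a b c d : Fin 2) :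
    (counter m).Reaches (idle p v, s) (read4 v a b c d, s) :=
  (reaches_idle_last p v s).trans ⟨_, run_idle_last v s a b c d⟩

theorem recent_reaches_idle (a b c d : Fin 2) (s : Bool) :
    (counter m).Reaches (recent a b c d, s) (idle 0 0, s) := by
  by_cases h : a = 0 ∧ b = 1 ∧ c = 0 ∧ d = 1
  · exact ⟨[0], by simp [counter_step, transition, successor, h]⟩
  -- The first two zeros separate the earlier letters from `0 1 0 1`, so that this pattern is not
  -- completed too early; the last letter triggers the return.
  · exact ⟨[0, 0, 1, 0, 1, 0], by simp [counter_step, transition, successor, h]⟩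

/-- Carry in 0 with carry out 1 is illegal for every digit, so reading `0 0 0 1 0` always flips the
sign. -/
theorem idle_reaches_not (p : Fin (m + 1)) (v : Fin 3) (s : Bool) :
    (counter m).Reaches (idle p v, s) (idle 0 0, !s) := by
  refine (idle_reaches_read4 p v s 0 0 0 1).trans (Reaches.trans ⟨[0], ?_⟩
    (recent_reaches_idle 0 0 1 0 (!s)))
  rw [run_cons, counter_step, transition, complete_of_ne (by revert v; decide) (by simp)]
  simp [successor]

theorem idle_reaches_idle_zero (p : Fin (m + 1)) (v : Fin 3) (s t : Bool) :
    (counter m).Reaches (idle p v, s) (idle 0 0, t) := by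
  rcases eq_or_ne t s with rfl | h
  · simpa using (idle_reaches_not p v t).trans (idle_reaches_not 0 0 (!t))
  · rw [show t = !s by revert s t; decide]
    exact idle_reaches_not p v s

theorem exists_reaches_idle (r : State m) (s : Bool) :
    ∃ p v t, (counter m).Reaches (r, s) (idle p v, t) := by
  have h4 : ∀ v a b c d s, ∃ p v' t,
      (counter m).Reaches (read4 v a b c d, s) (idle p v', t) := fun v a b c d s => by
    have h := reaches_step (read4 (m := m) v a b c d) s 0
    simp only [transition, complete] at h
    split_ifs at h with h1
    · exact ⟨_, _, _, h⟩
    · simp only [successor] at h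
      split_ifs at h with h2
      · exact ⟨_, _, _, h⟩
      · exact ⟨_, _, _, h.trans (recent_reaches_idle _ _ _ _ _)⟩
  have key : ∀ {r : State m} {v a b c d}, (counter m).Reaches (r, s) (read4 v a b c d, s) →
      ∃ p v t, (counter m).Reaches (r, s) (idle p v, t) := fun h => by
    obtain ⟨p, v, t, h'⟩ := h4 _ _ _ _ _ s
    exact ⟨p, v, t, h.trans h'⟩
  rcases r with ⟨p, v⟩ | ⟨v, d⟩ | ⟨v, c, d⟩ | ⟨v, b, c, d⟩ | ⟨v, a, b, c, d⟩ | ⟨a, b, c, d⟩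
  · exact ⟨p, v, s, .refl _ _⟩
  · exact key (v := v) (a := d) (b := 0) (c := 0) (d := 0)
      ⟨[0, 0, 0], by simp [counter_step, transition]⟩
  · exact key (v := v) (a := c) (b := d) (c := 0) (d := 0)
      ⟨[0, 0], by simp [counter_step, transition]⟩
  · exact key (v := v) (a := b) (b := c) (c := d) (d := 0)
      ⟨[0], by simp [counter_step, transition]⟩
  · exact h4 v a b c d s
  · exact ⟨0, 0, s, recent_reaches_idle _ _ _ _ _⟩

theorem idle_zero_reaches_digit (v : Fin 3) (s : Bool) :
    (counter m).Reaches (idle 0 0, s) (idle 0 v, s) := by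
  have h : ∀ v v' : Fin 3, v.val + 1 = v' →
      (counter m).Reaches (idle 0 v, s) (idle 0 v', s) := fun v v' hv => by
    refine (idle_reaches_read4 0 v s 0 0 1 0).trans ⟨[0], ?_⟩
    rw [run_cons, counter_step, transition, complete_of_eq (v' := v') (by simpa using hv)]
    simp
  have h1 := h 0 1 rfl
  have h2 := h1.trans (h 1 2 rfl)
  fin_cases v
  exacts [.refl _ _, h1, h2]

theorem idle_zero_reaches_state (r : State m) (s : Bool) :
    (counter m).Reaches (idle 0 0, s) (r, s) := by
  have hv := fun v => (idle_zero_reaches_digit v s).trans (idle_zero_reaches (Fin.last m) v s)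
  rcases r with ⟨p, v⟩ | ⟨v, d⟩ | ⟨v, c, d⟩ | ⟨v, b, c, d⟩ | ⟨v, a, b, c, d⟩ | ⟨a, b, c, d⟩
  · exact (idle_zero_reaches_digit v s).trans (idle_zero_reaches p v s)
  · exact (hv v).trans ⟨[d], by simp [counter_step, transition]⟩
  · exact (hv v).trans ⟨[c, d], by simp [counter_step, transition]⟩
  · exact (hv v).trans ⟨[b, c, d], by simp [counter_step, transition]⟩
  · exact (hv v).trans ⟨_, run_idle_last v s a b c d⟩
  -- An overflow enters the `recent` states without change of sign. The letters `1 1 1` then prevent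
  -- `0 1 0 1` from occurring before `a b c d` is stored.
  · refine (hv 2).trans ((Reaches.trans ⟨_, run_idle_last 2 s 1 1 1 0⟩ ⟨[1, 1, 1, 1, a, b, c, d], ?_⟩))
    rw [run_cons, counter_step, transition, complete_exit]
    simp [counter_step, transition, successor]

theorem counter_transitive (m : ℕ) : (counter m).Transitive := by
  rintro ⟨r, s⟩ ⟨r', s'⟩
  obtain ⟨p, v, t, h⟩ := exists_reaches_idle r s
  exact (h.trans (idle_reaches_idle_zero p v t s')).trans (idle_zero_reaches_state r' s')

theorem counter_loop : (counter m).step (recent 0 0 0 0, false) 0 = (recent 0 0 0 0, false) := by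
  simp [counter_step, transition, successor]

/-! ### Configurations of tokens -/

/-- The state of a token with digit `v` in place `n` of the cycle of `m + 5` places, when
`a b c d` are the last four letters. -/
def place (m n : ℕ) (v : Fin 3) (a b c d : Fin 2) : State m :=
  if h : n < m + 1 then idle ⟨n, h⟩ v
  else if n = m + 1 then read1 v d
  else if n = m + 2 then read2 v c d
  else if n = m + 3 then read3 v b c d
  else read4 v a b c d

theorem place_zero (v : Fin 3) (a b c d : Fin 2) : place m 0 v a b c d = idle 0 v := rfl

theorem place_last (v : Fin 3) (a b c d : Fin 2) : place m (m + 4) v a b c d = read4 v a b c d := by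
  simp [place]

theorem place_ne_recent (n : ℕ) (v : Fin 3) (a b c d a' b' c' d' : Fin 2) :
    place m n v a b c d ≠ recent a' b' c' d' := by
  unfold place
  split_ifs <;> simp

theorem transition_place {n : ℕ} (hn : n < m + 4) (v : Fin 3) (a b c d x : Fin 2) :
    transition m (place m n v a b c d) x = (place m (n + 1) v b c d x, false) := by
  rcases lt_or_ge n (m + 1) with h | h
  · rcases lt_or_ge (n + 1) (m + 1) with h' | h'
    · simp [place, transition, h, h']
    · obtain rfl : n = m := by omega
      simp [place, transition]
  · obtain rfl | rfl | rfl : n = m + 1 ∨ n = m + 2 ∨ n = m + 3 := by omega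
    all_goals simp [place, transition]

/-- The place of the token `l` when the token `i` is in the last place. -/
def placeIndex (m i l : ℕ) : ℕ := if i ≤ l then i + (m + 4) - l else i - l - 1

/-- The token whose turn comes after `i`; the turn `m + 4` is that of no token. -/
def nextTurn (m i : ℕ) : ℕ := if i = m + 4 then 0 else i + 1

theorem placeIndex_self (i : ℕ) : placeIndex m i i = m + 4 := by simp [placeIndex]

theorem placeIndex_lt {i l : ℕ} (hi : i ≤ m + 4) (h : i ≠ l) :
    placeIndex m i l < m + 4 := by
  unfold placeIndex; split_ifs <;> omega

theorem placeIndex_nextTurn {i l : ℕ} (hl : l < m + 4) (h : i ≠ l) :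
    placeIndex m (nextTurn m i) l = placeIndex m i l + 1 := by
  unfold placeIndex nextTurn; split_ifs <;> omega

theorem placeIndex_nextTurn_self (i : ℕ) :
    placeIndex m (nextTurn m i) i = 0 := by
  unfold placeIndex nextTurn; split_ifs <;> omega

/-- The token that marks the target. -/
def witness (m : ℕ) : State m × Bool := (recent 0 0 0 0, false)

/-- The initial state of token `l`. -/
def token (m l : ℕ) : State m × Bool := (place m (placeIndex m 0 l) 0 0 0 0 0, false)

/-- The witness and `m + 4` tokens with digit `0`. -/
def initial (m : ℕ) : Set (State m × Bool) := insert (witness m) (token m '' {l | l < m + 4})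

theorem witness_mem : witness m ∈ initial m := Set.mem_insert _ _

theorem token_mem {l : ℕ} (hl : l < m + 4) : token m l ∈ initial m := .inr ⟨l, hl, rfl⟩

/-- After `w`, which ends with `a b c d`, it is the turn of token `i`, the tokens `l < j` carry
the digits `v l`, and the others have joined the witness. -/
structure Config (m : ℕ) (w : List (Fin 2)) (j i : ℕ) (v : ℕ → Fin 3) (a b c d : Fin 2) : Prop where
  turn_le : i ≤ m + 4
  run_witness : (counter m).run (witness m) w = (recent a b c d, false)
  run_token : ∀ l < j, (counter m).run (token m l) w =
    (place m (placeIndex m i l) (v l) a b c d, false)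
  run_joined : ∀ l, j ≤ l → l < m + 4 → (counter m).run (token m l) w = (recent a b c d, false)

theorem config_nil : Config m [] (m + 4) 0 (fun _ => 0) 0 0 0 0 where
  turn_le := by omega
  run_witness := rfl
  run_token _ _ := rfl
  run_joined l h h' := by omega

namespace Config

variable {w : List (Fin 2)} {j i : ℕ} {v v' : ℕ → Fin 3} {a b c d : Fin 2}

theorem run_witness_concat (h : Config m w j i v a b c d) (x : Fin 2) :
    (counter m).run (witness m) (w ++ [x]) = (successor m a b c d x, false) := by
  simp [run_concat, h.run_witness, counter_step, transition]

theorem run_token_concat (h : Config m w j i v a b c d) (hj : j ≤ m + 4) {l : ℕ} (hl : l < j)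
    (hi : i ≠ l) (x : Fin 2) : (counter m).run (token m l) (w ++ [x]) =
      (place m (placeIndex m (nextTurn m i) l) (v l) b c d x, false) := by
  rw [run_concat, h.run_token l hl, counter_step, transition_place (placeIndex_lt h.turn_le hi),
    placeIndex_nextTurn (by omega) hi]
  rfl

theorem run_turn_concat (h : Config m w j i v a b c d) (hi : i < j) (x : Fin 2) :
    (counter m).run (token m i) (w ++ [x]) = complete m (v i) a b c d x := by
  rw [run_concat, h.run_token i hi, counter_step, placeIndex_self, place_last, transition]
  simp

theorem successor_eq {a b c d : Fin 2} (h : ¬ (a = 0 ∧ b = 1 ∧ c = 0 ∧ d = 1)) (x : Fin 2) :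
    successor m a b c d x = recent b c d x := if_neg h

theorem run_joined_concat (h : Config m w j i v a b c d) {l : ℕ} (hl : j ≤ l) (hl' : l < m + 4)
    (x : Fin 2) : (counter m).run (token m l) (w ++ [x]) = (successor m a b c d x, false) := by
  simp [run_concat, h.run_joined l hl hl', counter_step, transition]

theorem concat (h : Config m w j i v a b c d) (hj : j ≤ m + 4)
    (hne : ¬ (a = 0 ∧ b = 1 ∧ c = 0 ∧ d = 1)) (hv : ∀ l, l ≠ i → v' l = v l)
    (hi : i < j → (v i).val + c = v' i + 3 * d) (x : Fin 2) :
    Config m (w ++ [x]) j (nextTurn m i) v' b c d x where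
  turn_le := by
    have := h.turn_le
    unfold nextTurn; split_ifs <;> omega
  run_witness := by rw [h.run_witness_concat, successor_eq hne]
  run_token l hl := by
    rcases eq_or_ne i l with rfl | hil
    · rw [h.run_turn_concat hl, complete_of_eq (hi hl), placeIndex_nextTurn_self i,
        place_zero]
    · rw [h.run_token_concat hj hl hil, hv l hil.symm]
  run_joined l hl hl' := by rw [h.run_joined_concat hl hl', successor_eq hne]

theorem concat_exit (h : Config m w (j + 1) j v a b 1 0) (hj : j < m + 4) (hv : v j = 2) :
    Config m (w ++ [1]) j (nextTurn m j) v b 1 0 1 where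
  turn_le := by unfold nextTurn; split_ifs <;> omega
  run_witness := by rw [h.run_witness_concat, successor_eq (by simp)]
  run_token l hl := h.run_token_concat hj (by omega) (by omega) 1
  run_joined l hl hl' := by
    rcases eq_or_ne j l with rfl | hjl
    · rw [h.run_turn_concat (by omega), hv, complete_exit]
    · rw [h.run_joined_concat (by omega) hl', successor_eq (by simp)]

end Config

/-! ### The value of the counter -/

/-- The number that the first `j` tokens represent, with the carry for the token `i`. -/
def value (j i : ℕ) (v : ℕ → Fin 3) (c : Fin 2) : ℕ :=
  ∑ l ∈ Finset.range j, (v l).val * 3 ^ l + if i < j then c.val * 3 ^ i else 0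

theorem sum_digits_of_lt {j i : ℕ} {v v' : ℕ → Fin 3} (hi : i < j) (hv : ∀ l, l ≠ i → v' l = v l) :
    ∑ l ∈ Finset.range j, (v' l).val * 3 ^ l + (v i).val * 3 ^ i =
      ∑ l ∈ Finset.range j, (v l).val * 3 ^ l + (v' i).val * 3 ^ i := by
  have h := fun u : ℕ → Fin 3 => Finset.add_sum_erase (Finset.range j)
    (fun l => (u l).val * 3 ^ l) (Finset.mem_range.2 hi)
  have h' : ∑ l ∈ (Finset.range j).erase i, (v' l).val * 3 ^ l =
      ∑ l ∈ (Finset.range j).erase i, (v l).val * 3 ^ l :=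
    Finset.sum_congr rfl fun l hl => by rw [hv l (Finset.ne_of_mem_erase hl)]
  have h1 := h v
  have h2 := h v'
  omega

theorem value_of_le {j i : ℕ} {v v' : ℕ → Fin 3} (c : Fin 2) (hi : j ≤ i)
    (hv : ∀ l, l ≠ i → v' l = v l) : value j i v c = ∑ l ∈ Finset.range j, (v' l).val * 3 ^ l := by
  rw [value, if_neg (by omega), add_zero]
  exact Finset.sum_congr rfl fun l hl => by
    rw [hv l (by have := Finset.mem_range.1 hl; omega)]

/-- A legal turn preserves the number: the pending carry only moves up one position. -/
theorem value_of_lt {j i : ℕ} {v v' : ℕ → Fin 3} {c d : Fin 2} (hi : i < j)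
    (hv : ∀ l, l ≠ i → v' l = v l) (h : (v i).val + c = v' i + 3 * d) :
    value j i v c = ∑ l ∈ Finset.range j, (v' l).val * 3 ^ l + d * 3 ^ (i + 1) := by
  have h1 := sum_digits_of_lt hi hv
  have h2 : (v i).val * 3 ^ i + c * 3 ^ i = (v' i).val * 3 ^ i + d * 3 ^ (i + 1) := by
    rw [← add_mul, h]
    ring
  rw [value, if_pos hi]
  omega

theorem value_lt (j i : ℕ) (v : ℕ → Fin 3) (c : Fin 2) : value j i v c < 2 * 3 ^ j := by
  have h : ∀ j, ∑ l ∈ Finset.range j, (v l).val * 3 ^ l < 3 ^ j := by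
    intro j
    induction j with
    | zero => simp
    | succ j ih =>
      rw [Finset.sum_range_succ, pow_succ]
      have : (v j).val * 3 ^ j ≤ 2 * 3 ^ j := Nat.mul_le_mul_right _ (by omega)
      omega
  have h' : (if i < j then c.val * 3 ^ i else 0) ≤ 3 ^ j := by
    split_ifs with hi
    · calc c.val * 3 ^ i ≤ 1 * 3 ^ i := Nat.mul_le_mul_right _ (by omega)
        _ ≤ 3 ^ j := by rw [one_mul]; exact Nat.pow_le_pow_right (by omega) hi.le
    · exact Nat.zero_le _
  have := h j
  unfold value
  omega

/-! ### The lower bound -/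

/-- A token is about to complete the reading of `a b 0 1`, like the witness. -/
def Doomed (m : ℕ) (w : List (Fin 2)) : Prop :=
  ∃ l < m + 4, ∃ v a b, (counter m).run (witness m) w = (recent a b 0 1, false) ∧
    (counter m).run (token m l) w = (read4 v a b 0 1, false)

theorem hasTwins_of_illegal {w : List (Fin 2)} {l : ℕ} (hl : l < m + 4) {v : Fin 3}
    {a b c d x : Fin 2} (h : (counter m).run (witness m) w = (recent a b c d, false))
    (h' : (counter m).run (token m l) w = (read4 v a b c d, false))
    (hv : ∀ v' : Fin 3, v.val + c ≠ v' + 3 * d) (hx : ¬ (v = 2 ∧ c = 1 ∧ d = 0 ∧ x = 1)) :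
    (counter m).HasTwins (initial m) (w ++ [x]) := by
  refine ⟨witness m, witness_mem, token m l, token_mem hl, ?_⟩
  rw [run_concat, run_concat, h, h', counter_step, counter_step]
  simp [transition, complete_of_ne hv hx]

theorem Doomed.hasTwins_concat {w : List (Fin 2)} (h : Doomed m w) (x : Fin 2) :
    (counter m).HasTwins (initial m) (w ++ [x]) := by
  obtain ⟨l, hl, v, a, b, h, h'⟩ := h
  exact hasTwins_of_illegal hl h h' (fun v' => by simp; omega) (by simp)

/-- All tokens are on their way, and the counter has at most the value of the number of letters. -/
def Counting (m : ℕ) (w : List (Fin 2)) : Prop :=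
  ∃ i v a b c d, Config m w (m + 4) i v a b c d ∧ value (m + 4) i v c ≤ w.length ∧
    (i = m + 4 → ¬ (a = 0 ∧ b = 1)) ∧ (i = m + 3 → ¬ (b = 0 ∧ c = 1))

theorem counting_nil : Counting m [] :=
  ⟨0, _, _, _, _, _, config_nil, by simp [value], by omega, by omega⟩

/-- Only the empty turn `m + 4` can add a new carry, of at most one. The witness cannot leave at
that turn: `a b` are then the carries of token `m + 2`, whose legality excludes `0 1`. This is what
the two side conditions of `Counting` remember. -/
theorem Counting.concat {w : List (Fin 2)} (h : Counting m w) (x : Fin 2) :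
    Counting m (w ++ [x]) ∨ (counter m).HasTwins (initial m) (w ++ [x]) ∨ Doomed m (w ++ [x]) ∨
      3 ^ (m + 4) ≤ w.length := by
  obtain ⟨i, v, a, b, c, d, h, hV, h1, h2⟩ := h
  rcases h.turn_le.lt_or_eq with hi | rfl
  · have hnext : nextTurn m i = i + 1 := if_neg hi.ne
    by_cases hv : ∃ v' : Fin 3, (v i).val + c = v' + 3 * d
    · obtain ⟨v', hv⟩ := hv
      have hcd : ¬ (c = 0 ∧ d = 1) := by
        rintro ⟨rfl, rfl⟩
        simp at hv
        omega
      have hu : ∀ l, l ≠ i → Function.update v i v' l = v l :=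
        fun l hl => Function.update_of_ne hl _ _
      have hv' : (v i).val + c = (Function.update v i v' i).val + 3 * d := by simpa using hv
      refine .inl ⟨_, _, _, _, _, _, h.concat le_rfl (by tauto) hu (fun _ => hv') x, ?_, ?_, ?_⟩
      · rw [value_of_lt hi hu hv'] at hV
        rw [hnext, List.length_append, List.length_singleton]
        unfold value
        split_ifs <;> omega
      · rw [hnext]
        exact fun hi' => h2 (by omega)
      · exact fun _ => hcd
    · push Not at hv
      by_cases hx : v i = 2 ∧ c = 1 ∧ d = 0 ∧ x = 1
      · obtain ⟨hvi, rfl, rfl, rfl⟩ := hx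
        rcases Nat.lt_or_ge (i + 1) (m + 4) with hi' | hi'
        · refine .inr (.inr (.inl ⟨i + 1, hi', v (i + 1), b, 1, ?_, ?_⟩))
          · rw [h.run_witness_concat, Config.successor_eq (by simp)]
          · rw [h.run_token_concat le_rfl hi' (by omega), hnext, placeIndex_self, place_last]
        -- Digit 2 and carry 1 at position `m + 3` already contribute `3 * 3 ^ (m + 3)`.
        · refine .inr (.inr (.inr (le_trans ?_ hV)))
          have h3 : (v i).val * 3 ^ i ≤ ∑ l ∈ Finset.range (m + 4), (v l).val * 3 ^ l :=
            Finset.single_le_sum (f := fun l => (v l).val * 3 ^ l) (fun _ _ => Nat.zero_le _)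
              (Finset.mem_range.2 hi)
          rw [hvi] at h3
          obtain rfl : i = m + 3 := by omega
          rw [value, if_pos hi, pow_succ]
          simp at h3 ⊢
          omega
      · exact .inr (.inl (hasTwins_of_illegal hi h.run_witness
          (by rw [h.run_token i hi, placeIndex_self, place_last]) hv hx))
  · refine .inl ⟨_, v, _, _, _, _, h.concat le_rfl (by have := h1 rfl; tauto) (fun _ _ => rfl)
      (by omega) x, ?_, ?_, ?_⟩
    · rw [value_of_le (v' := v) c le_rfl (fun _ _ => rfl)] at hV
      simp only [nextTurn, if_true, value, List.length_append, List.length_singleton]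
      simp
      omega
    · simp [nextTurn]
    · simp [nextTurn]

theorem counting_or (w : List (Fin 2)) :
    Counting m w ∨ (counter m).HasTwins (initial m) w ∨ Doomed m w ∨ 3 ^ (m + 4) ≤ w.length := by
  induction w using List.reverseRecOn with
  | nil => exact .inl counting_nil
  | append_singleton w x ih =>
    have hle : w.length ≤ (w ++ [x]).length := by simp
    rcases ih with h | h | h | h
    · rcases h.concat x with h | h | h | h
      exacts [.inl h, .inr (.inl h), .inr (.inr (.inl h)), .inr (.inr (.inr (h.trans hle)))]
    · exact .inr (.inl (HasTwins.concat h x))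
    · exact .inr (.inl (h.hasTwins_concat x))
    · exact .inr (.inr (.inr (h.trans hle)))

theorem three_pow_le_length {w : List (Fin 2)} (h : ((counter m).image (initial m) w).ncard = 1) :
    3 ^ (m + 4) ≤ w.length := by
  obtain ⟨-, q, hq⟩ := (image_ncard_eq_one_iff _ _ _).1 h
  have hw := hq _ witness_mem
  rcases counting_or (m := m) w with ⟨i, v, a, b, c, d, h', -⟩ | h' | ⟨l, hl, v, a, b, h1, h2⟩ | h'
  · have h0 := hq _ (token_mem (l := 0) (by omega))
    rw [← hw, h'.run_token 0 (by omega), h'.run_witness] at h0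
    exact absurd (congrArg Prod.fst h0) (place_ne_recent _ _ _ _ _ _ _ _ _ _)
  · exact absurd h h'.ncard_ne_one
  · have h0 := hq _ (token_mem hl)
    rw [← hw, h1, h2] at h0
    simp at h0
  · exact h'

/-! ### Existence of a synchronizing word -/

/-- The invariants of a configuration with `j` tokens in which every letter is chosen as follows:
the correct carry between two of the tokens, `0` after the last one, `1` otherwise. -/
structure Good (m j i : ℕ) (v : ℕ → Fin 3) (a b c d : Fin 2) : Prop where
  carry : i + 1 < j → ∃ v' : Fin 3, (v i).val + c = v' + 3 * d
  last : i + 1 = j → d = 0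
  slot : j ≤ i → d = 1
  slot' : j + 2 ≤ i → c = 1
  prev : 1 ≤ i → i ≤ j → ¬ (b = 0 ∧ c = 1)
  prev' : 2 ≤ i → i ≤ j + 1 → ¬ (a = 0 ∧ b = 1)
  single : j = 1 → i = 0 → b = 1
  single' : j = 1 → i = 1 → a = 1

theorem exists_carry (v : Fin 3) (c : Fin 2) : ∃ (d : Fin 2) (v' : Fin 3),
    v.val + c = v' + 3 * d := by
  revert v c; decide

/-- At a token's turn `c d = 0 1` is excluded by the correct carry, or by `d = 0` at the top. Just
after the tokens `prev'` excludes `a b = 0 1`, and later `slot'` excludes `c = 0`. With one token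
left the four letters reach back into the previous round, hence `single'`. -/
theorem Good.not_leaving {j i : ℕ} {v : ℕ → Fin 3} {a b c d : Fin 2} (h : Good m (j + 1) i v a b c d) :
    ¬ (a = 0 ∧ b = 1 ∧ c = 0 ∧ d = 1) := by
  rintro ⟨rfl, rfl, rfl, rfl⟩
  rcases Nat.lt_or_ge (i + 1) (j + 1) with h1 | h1
  · obtain ⟨v', hv'⟩ := h.carry h1
    simp at hv'
    omega
  rcases h1.eq_or_lt with h1 | h1
  · simpa using h.last h1.symm
  rcases Nat.lt_or_ge i (j + 3) with h2 | h2
  · rcases Nat.lt_or_ge i 2 with h3 | h3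
    · simpa using h.single' (by omega) (by omega)
    · simpa using h.prev' h3 (by omega)
  · simpa using h.slot' (by omega)

theorem Good.concat {j i : ℕ} {v v' : ℕ → Fin 3} {a b c d : Fin 2} (h : Good m (j + 1) i v a b c d)
    (hj : j < m + 4) (hi : i ≤ m + 4) (hv : ∀ l, l ≠ i → v' l = v l)
    (hi' : i < j + 1 → (v i).val + c = v' i + 3 * d) :
    ∃ x, Good m (j + 1) (nextTurn m i) v' b c d x := by
  obtain ⟨x, hx1, hx2, hx3⟩ : ∃ x : Fin 2,
      (nextTurn m i + 1 < j + 1 →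
        ∃ u : Fin 3, (v' (nextTurn m i)).val + d = u + 3 * x) ∧
      (nextTurn m i + 1 = j + 1 → x = 0) ∧ (j + 1 ≤ nextTurn m i → x = 1) := by
    rcases lt_trichotomy (nextTurn m i + 1) (j + 1) with h1 | h1 | h1
    · obtain ⟨x, u, hu⟩ := exists_carry (v' (nextTurn m i)) d
      exact ⟨x, fun _ => ⟨u, hu⟩, by omega, by omega⟩
    · exact ⟨0, by omega, fun _ => rfl, by omega⟩
    · exact ⟨1, by omega, by omega, fun _ => rfl⟩
  refine ⟨x, ?_⟩
  rcases hi.lt_or_eq with hi | rfl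
  · rw [show nextTurn m i = i + 1 from if_neg hi.ne] at *
    refine ⟨hx1, hx2, hx3, fun h1 => h.slot (by omega), fun _ h1 => ?_,
      fun h1 h2 => h.prev (by omega) (by omega), by omega, fun h1 h2 => h.single h1 (by omega)⟩
    rcases Nat.lt_or_ge i (j + 1) with h2 | h2
    · rintro ⟨rfl, rfl⟩
      have := hi' h2
      simp at this
      omega
    · omega
  · rw [show nextTurn m (m + 4) = 0 from if_pos rfl] at *
    exact ⟨hx1, hx2, hx3, by omega, by omega, by omega, fun h1 _ => h.slot' (by omega), by omega⟩

/-- The departing token leaves a `0` at a turn that is now vacant; this is why `slot'` starts only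
at `j + 2`. -/
theorem Good.concat_exit {j : ℕ} {v : ℕ → Fin 3} {a b c d : Fin 2}
    (h : Good m (j + 1) j v a b c d) (hc : c = 1) :
    Good m j (j + 1) v b 1 0 1 where
  carry := by omega
  last := by omega
  slot _ := rfl
  slot' := by omega
  prev := by omega
  prev' h1 _ := by simpa [hc] using h.prev (by omega) (by omega)
  single := by omega
  single' := by omega

theorem Good.value_nextTurn {j i : ℕ} {v v' : ℕ → Fin 3} {a b c d : Fin 2}
    (h : Good m (j + 1) i v a b c d) (hi : i < m + 4) (hv : ∀ l, l ≠ i → v' l = v l)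
    (hi' : i < j + 1 → (v i).val + c = v' i + 3 * d) :
    value (j + 1) (nextTurn m i) v' d = value (j + 1) i v c := by
  rw [show nextTurn m i = i + 1 from if_neg hi.ne]
  rcases Nat.lt_or_ge i (j + 1) with h1 | h1
  · rw [value_of_lt h1 hv (hi' h1), value]
    split_ifs with h2
    · rfl
    · simp [h.last (by omega)]
  · rw [value_of_le c h1 hv, value, if_neg (by omega), add_zero]

theorem Good.value_nextTurn_last {j : ℕ} {v : ℕ → Fin 3} {a b c d : Fin 2}
    (h : Good m (j + 1) (m + 4) v a b c d) (hj : j < m + 4) :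
    value (j + 1) (nextTurn m (m + 4)) v d = value (j + 1) (m + 4) v c + 1 := by
  rw [value_of_le c hj (fun _ _ => rfl), show nextTurn m (m + 4) = 0 from if_pos rfl, value,
    if_pos (by omega), h.slot hj]
  simp

theorem two_one_of_ne (v : Fin 3) (c : Fin 2) :
    (∀ u : Fin 3, v.val + c ≠ u + 3 * (0 : Fin 2)) → v = 2 ∧ c = 1 := by
  revert v c
  decide

theorem exists_synchronizing_of_config (j : ℕ) (hj : j ≤ m + 4) {w : List (Fin 2)} {i : ℕ}
    {v : ℕ → Fin 3} {a b c d : Fin 2} (h : Config m w j i v a b c d) (hg : Good m j i v a b c d) :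
    ∃ w, ((counter m).image (initial m) w).ncard = 1 := by
  induction j generalizing w i v a b c d with
  | zero =>
    refine ⟨w, (image_ncard_eq_one_iff _ _ _).2 ⟨⟨_, witness_mem⟩, (recent a b c d, false), ?_⟩⟩
    rintro q (rfl | ⟨l, hl, rfl⟩)
    · exact h.run_witness
    · exact h.run_joined l (Nat.zero_le l) hl
  | succ j ihj =>
    -- The value rises by one per round and stays below `2 * 3 ^ (j + 1)`, so an overflow must come.
    -- The weight `m + 5` outweighs the return of `i` to 0.
    obtain ⟨N, hN⟩ : ∃ N, (2 * 3 ^ (j + 1) - value (j + 1) i v c) * (m + 5) + (m + 5 - i) ≤ N :=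
      ⟨_, le_rfl⟩
    induction N generalizing w i v a b c d with
    | zero =>
      have := h.turn_le
      omega
    | succ N ihN =>
      have key : ∀ v' : ℕ → Fin 3, (∀ l, l ≠ i → v' l = v l) →
          (i < j + 1 → (v i).val + c = v' i + 3 * d) → (i = m + 4 → v' = v) →
          ∃ w, ((counter m).image (initial m) w).ncard = 1 := by
        intro v' hv hi' hlast
        obtain ⟨x, hx⟩ := hg.concat (by omega) h.turn_le hv hi'
        refine ihN (h.concat hj hg.not_leaving hv hi' x) hx ?_
        rcases h.turn_le.lt_or_eq with hi | rfl
        · rw [hg.value_nextTurn hi hv hi', show nextTurn m i = i + 1 from if_neg hi.ne]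
          omega
        · obtain rfl := hlast rfl
          have hlt := value_lt (j + 1) (nextTurn m (m + 4)) v' d
          rw [hg.value_nextTurn_last (by omega)] at hlt ⊢
          obtain ⟨t, ht⟩ : ∃ t, 2 * 3 ^ (j + 1) = value (j + 1) (m + 4) v' c + 1 + t :=
            ⟨_, (Nat.add_sub_of_le hlt.le).symm⟩
          rw [ht, Nat.add_sub_cancel_left, show nextTurn m (m + 4) = 0 from if_pos rfl]
          rw [ht, show value (j + 1) (m + 4) v' c + 1 + t - value (j + 1) (m + 4) v' c = t + 1 by
            omega, add_mul] at hN
          omega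
      rcases Nat.lt_or_ge i (j + 1) with hi | hi
      · by_cases hv : ∃ u : Fin 3, (v i).val + c = u + 3 * d
        · obtain ⟨u, hu⟩ := hv
          exact key (Function.update v i u) (fun l hl => Function.update_of_ne hl _ _)
            (fun _ => by simpa using hu) (by omega)
        -- The carry equation can fail only at the top token, where the letter `0` is imposed; the
        -- failure is exactly the overflow.
        · obtain rfl : i = j := by
            by_contra hne
            exact hv (hg.carry (by omega))
          obtain rfl : d = 0 := hg.last rfl
          obtain ⟨hvi, rfl⟩ : v i = 2 ∧ c = 1 := by
            push Not at hv
            revert hv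
            exact two_one_of_ne (v i) c
          have := h.concat_exit hj hvi
          rw [show nextTurn m i = i + 1 from if_neg (by omega)] at this
          exact ihj (by omega) this (hg.concat_exit rfl)
      · exact key v (fun _ _ => rfl) (by omega) (fun _ => rfl)

theorem counter_slowlySynchronizable (m : ℕ) :
    (counter m).SlowlySynchronizable (initial m) (3 ^ (m + 4)) := by
  refine ⟨exists_synchronizing_of_config (m + 4) le_rfl config_nil ?_,
    fun w hw => three_pow_le_length hw⟩
  exact ⟨fun _ => ⟨0, rfl⟩, by omega, by omega, by omega, by omega, by omega, by omega, by omega⟩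

/-! ### All numbers of states, and asymptotics -/

/-- For every `n` there is a transitive binary automaton with `n` states and a subset that is
synchronized by words of length at least `3 ^ ((n - 218) / 6 + 4)` only. -/
theorem exists_fin_three_pow_le {n : ℕ} (hn : 1 ≤ n) :
    ∃ (M : Automaton (Fin n) (Fin 2)) (S : Set (Fin n)) (l : ℕ),
      M.Transitive ∧ M.ShortestSyncLength S l ∧ (218 ≤ n → 3 ^ ((n - 218) / 6 + 4) ≤ l) := by
  rcases Nat.lt_or_ge n 218 with h | h
  · obtain ⟨M, S, hM, hS⟩ := exists_fin_trivial hn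
    exact ⟨M, S, 0, hM, hS, by omega⟩
  · obtain ⟨M, S, l, hM, hS, hl⟩ := exists_fin_of_loop (n := n)
      (by rw [State.card_prod_bool (m := (n - 218) / 6)]; omega)
      (counter_transitive _) (counter_slowlySynchronizable _) counter_loop
    exact ⟨M, S, l, hM, hS, fun _ => hl⟩

end TernaryCounter

theorem isBigO_of_le_three_rpow {f : ℕ → ℝ} {len : ℕ → ℕ}
    (hlen : ∀ n, 218 ≤ n → 3 ^ ((n - 218) / 6 + 4) ≤ len n) (hb : ∀ n, 0 ≤ f n)
    (hf : ∀ n : ℕ, f n ≤ (3 : ℝ) ^ ((n : ℝ) / 6)) :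
    f =O[atTop] (fun n : ℕ => (len n : ℝ)) := by
  refine IsBigO.of_bound ((3 : ℝ) ^ (36 : ℝ)) ?_
  filter_upwards [eventually_ge_atTop 218] with n hn
  rw [Real.norm_of_nonneg (hb n), Real.norm_of_nonneg (Nat.cast_nonneg _)]
  have h1 : ((3 : ℝ) ^ ((n - 218) / 6 + 4) : ℝ) ≤ len n := by exact_mod_cast hlen n hn
  -- Here 36 is `218 / 6` rounded down; the summand 4 absorbs both roundings.
  have h2 : (n : ℝ) / 6 ≤ 36 + (((n - 218) / 6 + 4 : ℕ) : ℝ) := by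
    have : n ≤ 6 * (36 + ((n - 218) / 6 + 4)) := by omega
    have : (n : ℝ) ≤ 6 * (36 + (((n - 218) / 6 + 4 : ℕ) : ℝ)) := by exact_mod_cast this
    linarith
  calc f n ≤ (3 : ℝ) ^ ((n : ℝ) / 6) := hf n
    _ ≤ (3 : ℝ) ^ (36 + (((n - 218) / 6 + 4 : ℕ) : ℝ)) :=
      Real.rpow_le_rpow_of_exponent_le (by norm_num) h2
    _ = (3 : ℝ) ^ (36 : ℝ) * (3 : ℝ) ^ ((n - 218) / 6 + 4) := by
      rw [Real.rpow_add (by norm_num), Real.rpow_natCast]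
    _ ≤ (3 : ℝ) ^ (36 : ℝ) * len n := by gcongr

theorem mainTheorem7 :
    ∃ (M : ∀ n : ℕ, Automaton (Fin n) (Fin 2)) (S : ∀ n : ℕ, Set (Fin n)) (len : ℕ → ℕ),
      (∀ n : ℕ, 1 ≤ n → (M n).Transitive ∧ (M n).ShortestSyncLength (S n) (len n)) ∧
      (∀ ε : ℝ, 0 < ε → ε < 3 →
        (fun n : ℕ => (3 - ε) ^ ((n : ℝ) / 6)) =O[atTop] (fun n : ℕ => (len n : ℝ))) ∧
      (fun n : ℕ => (1.2009 : ℝ) ^ n) =O[atTop] (fun n : ℕ => (len n : ℝ)) := by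
  have h : ∀ n : ℕ, ∃ (M : Automaton (Fin n) (Fin 2)) (S : Set (Fin n)) (l : ℕ), 1 ≤ n →
      M.Transitive ∧ M.ShortestSyncLength S l ∧ (218 ≤ n → 3 ^ ((n - 218) / 6 + 4) ≤ l) := by
    intro n
    by_cases hn : 1 ≤ n
    · obtain ⟨M, S, l, h⟩ := TernaryCounter.exists_fin_three_pow_le hn
      exact ⟨M, S, l, fun _ => h⟩
    · exact ⟨⟨fun q _ => q⟩, ∅, 0, fun h => absurd h hn⟩
  choose M S len h using h
  have hlen : ∀ n, 218 ≤ n → 3 ^ ((n - 218) / 6 + 4) ≤ len n :=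
    fun n hn => (h n (by omega)).2.2 hn
  refine ⟨M, S, len, fun n hn => ⟨(h n hn).1, (h n hn).2.1⟩, fun ε hε hε' => ?_, ?_⟩
  · exact isBigO_of_le_three_rpow hlen (fun n => Real.rpow_nonneg (by linarith) _)
      fun n => Real.rpow_le_rpow (by linarith) (by linarith) (by positivity)
  · refine isBigO_of_le_three_rpow hlen (fun n => by positivity) fun n => ?_
    have h6 : (1.2009 : ℝ) ≤ (3 : ℝ) ^ (1 / 6 : ℝ) := by
      rw [← pow_le_pow_iff_left₀ (by norm_num) (by positivity) (n := 6) (by norm_num),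
        ← Real.rpow_natCast ((3 : ℝ) ^ (1 / 6 : ℝ)), ← Real.rpow_mul (by norm_num)]
      norm_num
    calc (1.2009 : ℝ) ^ n ≤ ((3 : ℝ) ^ (1 / 6 : ℝ)) ^ n := by gcongr
      _ = (3 : ℝ) ^ ((n : ℝ) / 6) := by
        rw [← Real.rpow_natCast, ← Real.rpow_mul (by norm_num)]
        congr 1
        ring
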